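/- Let $\mathcal R$ be a finite set of predicates with arities, and consider function-free first-order logic with equality over $\mathcal R$ and finitely many constants, which denote distinct elements of the domain. For a finite domain $\Delta$ (containing the constants), a possible world $\omega$ is a set of ground atoms $R(a_1,\dots,a_{\mathrm{arity}(R)})$ with $R\in\mathcal R$, $a_j\in\Delta$; let $N(R,\omega)$ be the number of atoms of $R$ in $\omega$. A cardinality constraint $|R|\bowtie k$, with $\bowtie\in\{=,\le,\ge,<,>\}$ and $k\in\mathbb N$, holds in $\omega$ if $N(R,\omega)\bowtie k$; such constraints are allowed as atomic formulas. For weight functions $w,\overline w$ on $\mathcal R$, a set $\Omega$ of worlds over $\Delta$ and a sentence $\Gamma$, put $$\mathrm{WFOMC}(\Gamma,w,\overline w,\Omega)=\sum_{\omega\in\Omega:\ \omega\models\Gamma}\ \prod_{R\in\mathcal R} w(R)^{N(R,\omega)}\,\overline w(R)^{|\Delta|^{\mathrm{arity}(R)}-N(R,\omega)},$$ and let $\mathrm{WFOMC}(\Gamma,w,\overline w,\Delta)$ be this count for the set of all worlds over $\Delta$. For a list $\Psi=(R_1,\dots,R_m)$ of predicates and $\mathbf n\in\mathbb N^m$ let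 $\mathrm{WMC}_{\Psi,\Gamma,\Delta}(\mathbf n,w,\overline w)$ be the same sum restricted to the models $\omega$ of $\Gamma$ over $\Delta$ with $N(R_i,\omega)=n_i$ for all $i$. Computing the WFOMC of $\Gamma$ is called domain-liftable if there is an algorithm that, for every finite domain $\Delta$ and all rational weights $w,\overline w$, computes $\mathrm{WFOMC}(\Gamma,w,\overline w,\Delta)$ from $|\Delta|$, $w$ and $\overline w$ in time polynomial in $|\Delta|$ and the number of bits needed to represent the weights. Algorithms are programs of a register machine with integer registers, with time measured in bit operations. **Proposition.** Let $\Gamma$ be a first-order sentence, let $\psi(x_1,\dots,x_m)$ be a propositional formula, and let $\Upsilon=\psi(|R_1|\bowtie_1 k_1,\dots,|R_m|\bowtie_m k_m)$ with $R_i\in\mathcal R$, $\bowtie_i\in\{=,\le,\ge,<,>\}$ and $k_i\in\mathbb N$. If computing the WFOMC of $\Gamma$ is domain-liftable, then computing the WFOMC of $\Gamma\wedge\Upsilon$ is domain-liftable. Moreover, with $\Psi=(R_1,\dots,R_m)$, for every finite domain $\Delta$ and all complex weights $w,\overline w$, $$\mathrm{WFOMC}(\Gamma\wedge\Upsilon,w,\overline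 w,\Delta)=\sum_{\mathbf n\in\mathcal D:\ \psi(n_1\bowtie_1k_1,\dots,n_m\bowtie_mk_m)\text{ is true}}\mathrm{WMC}_{\Psi,\Gamma,\Delta}(\mathbf n,w,\overline w),\qquad \mathcal D=\prod_{i=1}^m\{0,1,\dots,|\Delta|^{\mathrm{arity}(R_i)}\},$$ and $|\mathcal D|$ is bounded by a polynomial in $|\Delta|$. -/

import Mathlib

open FirstOrder

namespace WFOMC

/-! ### First-order sentences with cardinality constraints -/

/-- The comparison symbols `=, ≤, ≥, <, >`. -/
inductive Cmp
  | eq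
  | le
  | ge
  | lt
  | gt

/-- The meaning of a comparison symbol on natural numbers. -/
def Cmp.Holds : Cmp → ℕ → ℕ → Prop
  | .eq, n, k => n = k
  | .le, n, k => n ≤ k
  | .ge, n, k => n ≥ k
  | .lt, n, k => n < k
  | .gt, n, k => n > k

/-- A cardinality constraint `|R| ⋈ k` on a predicate `R` from the set `𝓡` of predicates. -/
structure CardConstraint (𝓡 : Type) where
  pred : 𝓡
  cmp : Cmp
  bound : ℕ

/-- Function symbols of the language: only constants, taken from `C`. -/
inductive FunSym (C : Type) : ℕ → Type
  | const (c : C) : FunSym C 0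

/-- Relation symbols of the language: the predicates `R ∈ 𝓡`, with their arities, and the
cardinality constraints, which are atomic formulas without arguments. -/
inductive RelSym {𝓡 : Type} (arity : 𝓡 → ℕ) : ℕ → Type
  | pred (R : 𝓡) : RelSym arity (arity R)
  | card (κ : CardConstraint 𝓡) : RelSym arity 0

/-- The function-free first-order language with predicates `𝓡`, constants `C` and equality, in which
cardinality constraints are allowed as atomic formulas. -/
def lang {𝓡 : Type} (arity : 𝓡 → ℕ) (C : Type) : Language where
  Functions := FunSym C
  Relations := RelSym arity

/-- The cardinality constraint `|R| ⋈ k` as a sentence. -/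
def CardConstraint.toSentence {𝓡 : Type} {arity : 𝓡 → ℕ} {C : Type} (κ : CardConstraint 𝓡) :
    (lang arity C).Sentence :=
  Language.Relations.formula (L := lang arity C) (n := 0) (RelSym.card κ) Fin.elim0

/-- Propositional formulas with variables in `V`. -/
inductive PropFormula (V : Type)
  | var (v : V)
  | false
  | not (φ : PropFormula V)
  | and (φ χ : PropFormula V)
  | or (φ χ : PropFormula V)
  | imp (φ χ : PropFormula V)
  | iff (φ χ : PropFormula V)

/-- Truth of a propositional formula under a valuation. -/
def PropFormula.Holds {V : Type} (v : V → Prop) : PropFormula V → Prop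
  | .var x => v x
  | .false => False
  | .not φ => ¬ φ.Holds v
  | .and φ χ => φ.Holds v ∧ χ.Holds v
  | .or φ χ => φ.Holds v ∨ χ.Holds v
  | .imp φ χ => φ.Holds v → χ.Holds v
  | .iff φ χ => φ.Holds v ↔ χ.Holds v

/-- The sentence obtained from a propositional formula by replacing its variables by sentences. -/
def PropFormula.subst {V : Type} {L : Language} (σ : V → L.Sentence) : PropFormula V → L.Sentence
  | .var x => σ x
  | .false => ⊥
  | .not φ => (φ.subst σ).not
  | .and φ χ => φ.subst σ ⊓ χ.subst σ
  | .or φ χ => φ.subst σ ⊔ χ.subst σ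
  | .imp φ χ => (φ.subst σ).imp (χ.subst σ)
  | .iff φ χ => (φ.subst σ).iff (χ.subst σ)

/-! ### Possible worlds and weighted first-order model counting -/

/-- Ground atoms `R(a₁, …, aₖ)` over the domain `Δ`. -/
abbrev GroundAtom {𝓡 : Type} (arity : 𝓡 → ℕ) (Δ : Type) : Type :=
  Σ R : 𝓡, (Fin (arity R) → Δ)

/-- A possible world over `Δ`: the set of ground atoms that are true in it. -/
abbrev World {𝓡 : Type} (arity : 𝓡 → ℕ) (Δ : Type) : Type :=
  Set (GroundAtom arity Δ)

/-- The cardinality `N(R, ω)` of the predicate `R` in the world `ω`. -/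
noncomputable def card {𝓡 : Type} {arity : 𝓡 → ℕ} {Δ : Type} (R : 𝓡) (ω : World arity Δ) : ℕ :=
  {x : Fin (arity R) → Δ | (⟨R, x⟩ : GroundAtom arity Δ) ∈ ω}.ncard

/-- Satisfaction of a cardinality constraint in a world. -/
def CardConstraint.Holds {𝓡 : Type} {arity : 𝓡 → ℕ} {Δ : Type} (κ : CardConstraint 𝓡)
    (ω : World arity Δ) : Prop :=
  κ.cmp.Holds (card κ.pred ω) κ.bound

/-- The first-order structure given by a possible world, when the constants are read as elements of
the domain through `c`. -/
abbrev toStructure {𝓡 : Type} {arity : 𝓡 → ℕ} {C Δ : Type} (c : C → Δ) (ω : World arity Δ) :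
    (lang arity C).Structure Δ where
  funMap := fun {_} f _ => match f with
    | FunSym.const a => c a
  RelMap := fun {_} r x => match r, x with
    | RelSym.pred R, x => (⟨R, x⟩ : GroundAtom arity Δ) ∈ ω
    | RelSym.card κ, _ => κ.Holds ω

/-- The satisfaction relation `ω ⊨ Γ`. -/
def Models {𝓡 : Type} {arity : 𝓡 → ℕ} {C Δ : Type} (c : C → Δ) (ω : World arity Δ)
    (Γ : (lang arity C).Sentence) : Prop :=
  @Language.Sentence.Realize (lang arity C) Δ (toStructure c ω) Γ

open Classical in
/-- `WFOMC(Γ, w, w̄, Ω)` for a set `Ω` of possible worlds over the domain `Δ`. -/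
noncomputable def wfomcOn {𝓡 : Type} [Fintype 𝓡] {arity : 𝓡 → ℕ} {C Δ : Type} [Fintype Δ]
    {K : Type} [CommSemiring K] (c : C → Δ) (Γ : (lang arity C).Sentence) (w wbar : 𝓡 → K)
    (Ω : Set (World arity Δ)) : K :=
  ∑ ω : World arity Δ with ω ∈ Ω ∧ Models c ω Γ,
    ∏ R : 𝓡, w R ^ card R ω * wbar R ^ (Fintype.card Δ ^ arity R - card R ω)

/-- `WFOMC(Γ, w, w̄, Δ)`: the sum ranges over all possible worlds over `Δ`. -/
noncomputable def wfomc {𝓡 : Type} [Fintype 𝓡] {arity : 𝓡 → ℕ} {C Δ : Type} [Fintype Δ]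
    {K : Type} [CommSemiring K] (c : C → Δ) (Γ : (lang arity C).Sentence) (w wbar : 𝓡 → K) : K :=
  wfomcOn c Γ w wbar Set.univ

/-- The weighted model-counting function `WMC_{Ψ,Γ,Δ}(n, w, w̄)` of a list `Ψ` of predicates: the
weighted count of the models `ω` of `Γ` with `N(Ψ, ω) = n`. -/
noncomputable def wmc {𝓡 : Type} [Fintype 𝓡] {arity : 𝓡 → ℕ} {C Δ : Type} [Fintype Δ]
    {K : Type} [CommSemiring K] (c : C → Δ) {m : ℕ} (Ψ : Fin m → 𝓡) (Γ : (lang arity C).Sentence)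
    (n : Fin m → ℕ) (w wbar : 𝓡 → K) : K :=
  wfomcOn c (⊤ : (lang arity C).Sentence) w wbar
    {ω | Models c ω Γ ∧ ∀ i, card (Ψ i) ω = n i}

/-! ### Algorithms and their running time

Algorithms are programs of a register machine. A program uses finitely many registers, each of which
holds an integer of arbitrary size, and time is measured in bit operations: an instruction costs the
bit length of its operands for constants, additions, subtractions and sign tests, and the product
of the bit lengths for multiplications and divisions. Up to a polynomial this is the
running time on a multitape Turing machine: a Turing machine carries out each instruction in time
polynomial in its cost, and, conversely, a half of a tape is an integer written in binary, on which
pushing and popping a symbol are multiplication and division with remainder by a constant. -/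

/-- The arithmetic operations of the machine; `div` is division with remainder. -/
inductive Op
  | add
  | sub
  | mul
  | div

/-- The result of an operation. (Division by `0` gives `0`.) -/
def Op.eval : Op → ℤ → ℤ → ℤ
  | .add, a, b => a + b
  | .sub, a, b => a - b
  | .mul, a, b => a * b
  | .div, a, b => a / b

/-- The number of bits of an integer, including its sign. -/
def bitLength (z : ℤ) : ℕ := z.natAbs.size + 1

/-- The number of bit operations charged for an operation. -/
def Op.cost : Op → ℤ → ℤ → ℕ
  | .add, a, b => bitLength a + bitLength b
  | .sub, a, b => bitLength a + bitLength b
  | .mul, a, b => bitLength a * bitLength b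
  | .div, a, b => bitLength a * bitLength b

/-- Programs with registers from `ρ`. -/
inductive Prog (ρ : Type)
  | skip
  /-- `d := z` -/
  | const (d : ρ) (z : ℤ)
  /-- `d := a ∘ b` -/
  | arith (o : Op) (d a b : ρ)
  /-- `p; q` -/
  | seq (p q : Prog ρ)
  /-- `if a > 0 then p else q` -/
  | ite (a : ρ) (p q : Prog ρ)
  /-- `while a > 0 do p` -/
  | loop (a : ρ) (p : Prog ρ)

open Classical in
/-- The register contents `s` after the assignment `d := z`. -/
noncomputable def assign {ρ : Type} (s : ρ → ℤ) (d : ρ) (z : ℤ) : ρ → ℤ :=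
  Function.update s d z

/-- `Exec p s s' t`: started with register contents `s`, the program `p` halts with register
contents `s'` after time `t`. -/
inductive Exec {ρ : Type} : Prog ρ → (ρ → ℤ) → (ρ → ℤ) → ℕ → Prop
  | skip (s : ρ → ℤ) : Exec .skip s s 1
  | const (d : ρ) (z : ℤ) (s : ρ → ℤ) : Exec (.const d z) s (assign s d z) (bitLength z)
  | arith (o : Op) (d a b : ρ) (s : ρ → ℤ) :
      Exec (.arith o d a b) s (assign s d (o.eval (s a) (s b))) (o.cost (s a) (s b))
  | seq {p q : Prog ρ} {s s' s'' : ρ → ℤ} {t t' : ℕ} (hp : Exec p s s' t)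
      (hq : Exec q s' s'' t') : Exec (.seq p q) s s'' (t + t')
  | ite_pos {a : ρ} {p q : Prog ρ} {s s' : ρ → ℤ} {t : ℕ} (ha : 0 < s a) (hp : Exec p s s' t) :
      Exec (.ite a p q) s s' (bitLength (s a) + t)
  | ite_neg {a : ρ} {p q : Prog ρ} {s s' : ρ → ℤ} {t : ℕ} (ha : ¬ 0 < s a)
      (hq : Exec q s s' t) : Exec (.ite a p q) s s' (bitLength (s a) + t)
  | loop_stop {a : ρ} {p : Prog ρ} {s : ρ → ℤ} (ha : ¬ 0 < s a) :
      Exec (.loop a p) s s (bitLength (s a))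
  | loop_step {a : ρ} {p : Prog ρ} {s s' s'' : ρ → ℤ} {t t' : ℕ} (ha : 0 < s a)
      (hp : Exec p s s' t) (hl : Exec (.loop a p) s' s'' t') :
      Exec (.loop a p) s s'' (bitLength (s a) + t + t')

/-- The registers of an algorithm for WFOMC: input registers for the size of the domain and for the
weights (as reduced fractions), output registers for the count (as a fraction), and work
registers. -/
inductive Reg (𝓡 : Type)
  | size
  | wNum (R : 𝓡)
  | wDen (R : 𝓡)
  | wbarNum (R : 𝓡)
  | wbarDen (R : 𝓡)
  | outNum
  | outDen
  | work (i : ℕ)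

/-- The register contents at the start, on a domain of size `n` with weights `w`, `wbar`. -/
def input {𝓡 : Type} (n : ℕ) (w wbar : 𝓡 → ℚ) : Reg 𝓡 → ℤ
  | .size => n
  | .wNum R => (w R).num
  | .wDen R => (w R).den
  | .wbarNum R => (wbar R).num
  | .wbarDen R => (wbar R).den
  | .outNum => 0
  | .outDen => 0
  | .work _ => 0

/-- The number of bits needed to represent a rational number. -/
def ratBits (q : ℚ) : ℕ := bitLength q.num + bitLength q.den

/-- The number of bits needed to represent the weights. -/
def weightBits {𝓡 : Type} [Fintype 𝓡] (w wbar : 𝓡 → ℚ) : ℕ :=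
  ∑ R : 𝓡, (ratBits (w R) + ratBits (wbar R))

/-- Computing the WFOMC of `Γ` is domain-liftable: there is an algorithm which, for all finite domains
`Δ` (containing the constants as distinct elements) and all rational weights, computes
`WFOMC(Γ, w, w̄, Δ)` in time polynomial in the size of the domain and the number of bits needed to
represent the weights. -/
def DomainLiftable {𝓡 : Type} [Fintype 𝓡] {arity : 𝓡 → ℕ} {C : Type}
    (Γ : (lang arity C).Sentence) : Prop :=
  ∃ (A : Prog (Reg 𝓡)) (P : Polynomial ℕ),
    ∀ (Δ : Type) [Fintype Δ] (c : C ↪ Δ) (w wbar : 𝓡 → ℚ),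
      ∃ (s : Reg 𝓡 → ℤ) (t : ℕ),
        Exec A (input (Fintype.card Δ) w wbar) s t ∧
        t ≤ P.eval (Fintype.card Δ + weightBits w wbar) ∧
        s .outDen ≠ 0 ∧
        (s .outNum : ℚ) / (s .outDen : ℚ) = wfomc c Γ w wbar

/-- The set `{0, …, |Δ|^arity(R₁)} × ⋯ × {0, …, |Δ|^arity(Rₘ)}` of cardinality vectors of a list
`Ψ = (R₁, …, Rₘ)` of predicates over a domain of size `n`. -/
def cardVectors {𝓡 : Type} (arity : 𝓡 → ℕ) {m : ℕ} (Ψ : Fin m → 𝓡) (n : ℕ) :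
    Finset (Fin m → ℕ) :=
  Fintype.piFinset fun i => Finset.range (n ^ arity (Ψ i) + 1)

end WFOMC

/-! Replace the weight of one predicate `R` by `w R * X`. The WFOMC becomes a polynomial in `X`
whose `j`-th coefficient `c_j` is the weighted count of the models with exactly `j` atoms of `R`
(`wfomc_update`). One call of the given algorithm, at a single huge integer `X`, yields every `c_j`.
Indeed, some integer `D` with polynomially many bits clears all denominators and satisfies `|c_j| ≤
D` (`exists_int_weightScale_mul_wfomcOn`, `abs_wfomcOn_le`). So the `D * c_j` are integers of
absolute value at most `D²`. Once `X > 2D²`, they are the signed base-`X` digits of `D` times the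
output, and repeated division reads them off (`signedDigit_sum`).

The bounds `k` are fixed, so `= k`, `< k` and `≤ k` each need a fixed number of digits; `≥ k` and `>
k` follow by subtraction from the count of `Γ`. A cardinality constraint is itself a sentence of the
language, so `Γ ⊓ κ` is again a liftable sentence and the step can be repeated. Induction on `ψ`,
with inclusion and subtraction for the connectives, gives liftability (`DomainLiftable.inf_subst`).

The running time is controlled by `PolyComputable`, a class of functions closed under arithmetic,
powers with small exponents and subroutine calls. The summation formula merely sorts the models by
their cardinality vector. -/

namespace WFOMC

/-! ### Polynomial bounds -/

section Bounds

variable {ι : Type*} {sz f g : ι → ℕ}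

/-- `f` is bounded by a polynomial in `sz`. -/
def PolyBounded (sz f : ι → ℕ) : Prop := ∃ P : Polynomial ℕ, ∀ i, f i ≤ P.eval (sz i)

theorem polynomial_eval_mono (P : Polynomial ℕ) {a b : ℕ} (h : a ≤ b) : P.eval a ≤ P.eval b := by
  simp only [Polynomial.eval_eq_sum_range]
  gcongr

theorem PolyBounded.mono (hg : PolyBounded sz g) (h : ∀ i, f i ≤ g i) : PolyBounded sz f := by
  obtain ⟨P, hP⟩ := hg
  exact ⟨P, fun i => (h i).trans (hP i)⟩

theorem PolyBounded.self : PolyBounded sz sz := ⟨Polynomial.X, fun i => by simp⟩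

theorem PolyBounded.const (k : ℕ) : PolyBounded sz fun _ => k :=
  ⟨Polynomial.C k, fun i => by simp⟩

theorem PolyBounded.add (hf : PolyBounded sz f) (hg : PolyBounded sz g) :
    PolyBounded sz fun i => f i + g i := by
  obtain ⟨P, hP⟩ := hf
  obtain ⟨Q, hQ⟩ := hg
  exact ⟨P + Q, fun i => by simpa using add_le_add (hP i) (hQ i)⟩

theorem PolyBounded.mul (hf : PolyBounded sz f) (hg : PolyBounded sz g) :
    PolyBounded sz fun i => f i * g i := by
  obtain ⟨P, hP⟩ := hf
  obtain ⟨Q, hQ⟩ := hg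
  exact ⟨P * Q, fun i => by simpa using Nat.mul_le_mul (hP i) (hQ i)⟩

theorem PolyBounded.pow (hf : PolyBounded sz f) (k : ℕ) : PolyBounded sz fun i => f i ^ k := by
  obtain ⟨P, hP⟩ := hf
  exact ⟨P ^ k, fun i => by simpa using Nat.pow_le_pow_left (hP i) k⟩

theorem PolyBounded.sum {α : Type*} (s : Finset α) {F : α → ι → ℕ}
    (h : ∀ a ∈ s, PolyBounded sz (F a)) : PolyBounded sz fun i => ∑ a ∈ s, F a i := by
  classical
  induction s using Finset.induction_on with
  | empty => simpa using PolyBounded.const 0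
  | insert a s ha ih =>
    simp only [Finset.sum_insert ha]
    exact (h a (by simp)).add (ih fun b hb => h b (by simp [hb]))

theorem PolyBounded.eval (P : Polynomial ℕ) (hf : PolyBounded sz f) :
    PolyBounded sz fun i => P.eval (f i) := by
  obtain ⟨Q, hQ⟩ := hf
  exact ⟨P.comp Q, fun i => by
    simpa [Polynomial.eval_comp] using polynomial_eval_mono P (hQ i)⟩

theorem PolyBounded.comp {κ : Type*} (hf : PolyBounded sz f) (e : κ → ι) :
    PolyBounded (fun k => sz (e k)) fun k => f (e k) := by
  obtain ⟨P, hP⟩ := hf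
  exact ⟨P, fun k => hP (e k)⟩

end Bounds

/-! ### Bit lengths -/

theorem one_le_bitLength (z : ℤ) : 1 ≤ bitLength z := Nat.le_add_left _ _

theorem bitLength_mono {a b : ℤ} (h : a.natAbs ≤ b.natAbs) : bitLength a ≤ bitLength b :=
  Nat.add_le_add_right (Nat.size_le_size h) 1

theorem bitLength_natCast_le (n : ℕ) : bitLength n ≤ n + 1 := by
  have : Nat.size n ≤ n := Nat.size_le.2 Nat.lt_two_pow_self
  simpa [bitLength] using this

theorem bitLength_add_le (a b : ℤ) : bitLength (a + b) ≤ bitLength a + bitLength b := by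
  have ha := Nat.lt_size_self a.natAbs
  have hb := Nat.lt_size_self b.natAbs
  have hab := Int.natAbs_add_le a b
  have h1 : 2 ^ a.natAbs.size ≤ 2 ^ (a.natAbs.size + b.natAbs.size) :=
    Nat.pow_le_pow_right (by norm_num) (Nat.le_add_right _ _)
  have h2 : 2 ^ b.natAbs.size ≤ 2 ^ (a.natAbs.size + b.natAbs.size) :=
    Nat.pow_le_pow_right (by norm_num) (Nat.le_add_left _ _)
  have : (a + b).natAbs.size ≤ a.natAbs.size + b.natAbs.size + 1 := by
    rw [Nat.size_le, pow_succ]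
    omega
  simp only [bitLength]
  omega

theorem bitLength_neg (a : ℤ) : bitLength (-a) = bitLength a := by simp [bitLength]

theorem natAbs_size_mul_le (a b : ℤ) :
    (a * b).natAbs.size ≤ a.natAbs.size + b.natAbs.size := by
  rw [Nat.size_le, Int.natAbs_mul, pow_add]
  exact Nat.mul_lt_mul'' (Nat.lt_size_self _) (Nat.lt_size_self _)

theorem bitLength_mul_le (a b : ℤ) : bitLength (a * b) ≤ bitLength a * bitLength b := by
  have := natAbs_size_mul_le a b
  simp only [bitLength]
  nlinarith [Nat.zero_le (a.natAbs.size * b.natAbs.size)]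

theorem bitLength_mul_le_add (a b : ℤ) : bitLength (a * b) ≤ bitLength a + bitLength b := by
  have := natAbs_size_mul_le a b
  simp only [bitLength]
  omega

theorem bitLength_pow_le (a : ℤ) (n : ℕ) : bitLength (a ^ n) ≤ n * bitLength a + 2 := by
  induction n with
  | zero => simp [bitLength]
  | succ n ih =>
    rw [pow_succ]
    have := bitLength_mul_le_add (a ^ n) a
    rw [add_mul]
    omega

/-- The cost model charges at least the size of the result, which is why running time controls
register size. -/
theorem Op.bitLength_eval_le (o : Op) (a b : ℤ) : bitLength (o.eval a b) ≤ o.cost a b := by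
  cases o with
  | add => exact bitLength_add_le a b
  | sub =>
    simpa [Op.eval, Op.cost, sub_eq_add_neg, bitLength_neg] using bitLength_add_le a (-b)
  | mul => exact bitLength_mul_le a b
  | div =>
    refine (bitLength_mono (Int.natAbs_ediv_le_natAbs a b)).trans ?_
    exact Nat.le_mul_of_pos_right _ (one_le_bitLength b)

theorem assign_apply {ρ : Type} [DecidableEq ρ] (s : ρ → ℤ) (d : ρ) (z : ℤ) (r : ρ) :
    assign s d z r = if r = d then z else s r := by
  simp [assign, Function.update_apply]

theorem assign_self {ρ : Type} (s : ρ → ℤ) (d : ρ) (z : ℤ) : assign s d z d = z := by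
  simp [assign]

theorem assign_of_ne {ρ : Type} (s : ρ → ℤ) {d r : ρ} (h : r ≠ d) (z : ℤ) :
    assign s d z r = s r := by
  simp [assign, h]

/-- No register outgrows the running time. -/
theorem Exec.bitLength_le {ρ : Type} {p : Prog ρ} {s s' : ρ → ℤ} {t : ℕ} (h : Exec p s s' t)
    (r : ρ) : bitLength (s' r) ≤ bitLength (s r) + t := by
  classical
  induction h with
  | skip s => omega
  | const d z s => rw [assign_apply]; split_ifs <;> omega
  | arith o d a b s =>
    rw [assign_apply]
    have := o.bitLength_eval_le (s a) (s b)
    split_ifs <;> omega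
  | seq _ _ ih ih' => omega
  | ite_pos _ _ ih => omega
  | ite_neg _ _ ih => omega
  | loop_stop _ => omega
  | loop_step _ _ _ ih ih' => omega

/-! ### Renaming of registers -/

/-- The program in which every register `r` is replaced by `f r`. -/
def Prog.map {ρ ρ' : Type} (f : ρ → ρ') : Prog ρ → Prog ρ'
  | .skip => .skip
  | .const d z => .const (f d) z
  | .arith o d a b => .arith o (f d) (f a) (f b)
  | .seq p q => .seq (p.map f) (q.map f)
  | .ite a p q => .ite (f a) (p.map f) (q.map f)
  | .loop a p => .loop (f a) (p.map f)

/-- The registers which occur in a program. -/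
def Prog.regs {ρ : Type} : Prog ρ → Set ρ
  | .skip => ∅
  | .const d _ => {d}
  | .arith _ d a b => {d, a, b}
  | .seq p q => p.regs ∪ q.regs
  | .ite a p q => {a} ∪ p.regs ∪ q.regs
  | .loop a p => {a} ∪ p.regs

theorem Prog.finite_regs {ρ : Type} (p : Prog ρ) : p.regs.Finite := by
  induction p with
  | skip => exact Set.finite_empty
  | const => exact Set.finite_singleton _
  | arith => simp [Prog.regs]
  | seq p q hp hq => exact hp.union hq
  | ite a p q hp hq => exact ((Set.finite_singleton a).union hp).union hq
  | loop a p hp => exact (Set.finite_singleton a).union hp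

theorem assign_map_agree {ρ ρ' : Type} {f : ρ → ρ'} {U : Set ρ} (hf : U.InjOn f) {s : ρ → ℤ}
    {σ : ρ' → ℤ} (h : ∀ r ∈ U, σ (f r) = s r) {d : ρ} (hd : d ∈ U) (z : ℤ) :
    (∀ r ∈ U, assign σ (f d) z (f r) = assign s d z r) ∧
      ∀ x, x ∉ f '' U → assign σ (f d) z x = σ x := by
  classical
  refine ⟨fun r hr => ?_, fun x hx => assign_of_ne _ ?_ _⟩
  · rw [assign_apply, assign_apply, hf.eq_iff hr hd, h r hr]
  · rintro rfl
    exact hx ⟨d, hd, rfl⟩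

/-- A renamed program acts on the renamed registers as the original one, and changes no others. -/
theorem Exec.map {ρ ρ' : Type} {f : ρ → ρ'} {U : Set ρ} (hf : U.InjOn f) {p : Prog ρ}
    {s s' : ρ → ℤ} {t : ℕ} (h : Exec p s s' t) :
    p.regs ⊆ U → ∀ σ : ρ' → ℤ, (∀ r ∈ U, σ (f r) = s r) →
      ∃ σ', Exec (p.map f) σ σ' t ∧ (∀ r ∈ U, σ' (f r) = s' r) ∧
        ∀ x, x ∉ f '' U → σ' x = σ x := by
  induction h with
  | skip s => exact fun _ σ hσ => ⟨σ, .skip σ, hσ, fun _ _ => rfl⟩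
  | const d z s =>
    intro hU σ hσ
    exact ⟨_, .const (f d) z σ, assign_map_agree hf hσ (hU (by simp [Prog.regs])) z⟩
  | arith o d a b s =>
    intro hU σ hσ
    have ha := hσ a (hU (by simp [Prog.regs]))
    have hb := hσ b (hU (by simp [Prog.regs]))
    refine ⟨_, ?_, assign_map_agree hf hσ (hU (by simp [Prog.regs])) _⟩
    rw [← ha, ← hb]
    exact .arith o (f d) (f a) (f b) σ
  | seq _ _ ih ih' =>
    intro hU σ hσ
    simp only [Prog.regs, Set.union_subset_iff] at hU
    obtain ⟨σ₁, e₁, h₁, k₁⟩ := ih hU.1 σ hσ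
    obtain ⟨σ₂, e₂, h₂, k₂⟩ := ih' hU.2 σ₁ h₁
    exact ⟨σ₂, e₁.seq e₂, h₂, fun x hx => (k₂ x hx).trans (k₁ x hx)⟩
  | @ite_pos a _ _ s _ _ ha _ ih =>
    intro hU σ hσ
    simp only [Prog.regs, Set.union_subset_iff, Set.singleton_subset_iff] at hU
    obtain ⟨σ₁, e₁, h₁⟩ := ih hU.1.2 σ hσ
    rw [← hσ a hU.1.1] at ha ⊢
    exact ⟨σ₁, .ite_pos ha e₁, h₁⟩
  | @ite_neg a _ _ s _ _ ha _ ih =>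
    intro hU σ hσ
    simp only [Prog.regs, Set.union_subset_iff, Set.singleton_subset_iff] at hU
    obtain ⟨σ₁, e₁, h₁⟩ := ih hU.2 σ hσ
    rw [← hσ a hU.1.1] at ha ⊢
    exact ⟨σ₁, .ite_neg ha e₁, h₁⟩
  | loop_stop ha =>
    rename_i a _ s
    intro hU σ hσ
    simp only [Prog.regs, Set.union_subset_iff, Set.singleton_subset_iff] at hU
    rw [← hσ a hU.1] at ha ⊢
    exact ⟨σ, Exec.loop_stop ha, hσ, fun _ _ => rfl⟩
  | @loop_step a _ s _ _ _ _ ha _ _ ih ih' =>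
    intro hU σ hσ
    have hU' := hU
    simp only [Prog.regs, Set.union_subset_iff, Set.singleton_subset_iff] at hU'
    obtain ⟨σ₁, e₁, h₁, k₁⟩ := ih hU'.2 σ hσ
    obtain ⟨σ₂, e₂, h₂, k₂⟩ := ih' hU σ₁ h₁
    rw [← hσ a hU'.1] at ha ⊢
    exact ⟨σ₂, .loop_step ha e₁ e₂, h₂, fun x hx => (k₂ x hx).trans (k₁ x hx)⟩

/-- Execution of a loop with `n` rounds. -/
theorem Exec.loop_of_rounds {ρ : Type} {a : ρ} {p : Prog ρ} (n : ℕ) :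
    ∀ (S : ℕ → ρ → ℤ) (t : ℕ → ℕ), (∀ j < n, 0 < S j a) → ¬ 0 < S n a →
      (∀ j < n, Exec p (S j) (S (j + 1)) (t j)) →
      Exec (.loop a p) (S 0) (S n)
        ((∑ j ∈ Finset.range n, (bitLength (S j a) + t j)) + bitLength (S n a)) := by
  induction n with
  | zero =>
    intro S t _ hn _
    simpa using Exec.loop_stop hn
  | succ n ih =>
    intro S t hpos hn hp
    have h := ih (fun j => S (j + 1)) (fun j => t (j + 1)) (fun j hj => hpos _ (by omega)) hn
      fun j hj => hp _ (by omega)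
    have h' := Exec.loop_step (hpos 0 (by omega)) (hp 0 (by omega)) h
    rw [Finset.sum_range_succ']
    convert h' using 1
    omega

/-! ### Polynomial-time state transformations -/

section Reach

variable {ι : Type*} {ρ : Type} {sz : ι → ℕ} {G F H : ι → ρ → ℤ}

/-- The bit length of every register is bounded by a polynomial. -/
def BoundedState (sz : ι → ℕ) (G : ι → ρ → ℤ) : Prop :=
  ∀ r, PolyBounded sz fun i => bitLength (G i r)

/-- Some program leads from `G i` to `F i`, for every `i`, in polynomial time. -/
def PolyReach (sz : ι → ℕ) (G F : ι → ρ → ℤ) : Prop :=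
  ∃ (p : Prog ρ) (T : ι → ℕ), PolyBounded sz T ∧ ∀ i, Exec p (G i) (F i) (T i)

theorem PolyReach.trans (h : PolyReach sz G F) (h' : PolyReach sz F H) : PolyReach sz G H := by
  obtain ⟨p, T, hT, hp⟩ := h
  obtain ⟨q, T', hT', hq⟩ := h'
  exact ⟨.seq p q, _, hT.add hT', fun i => (hp i).seq (hq i)⟩

theorem PolyReach.refl : PolyReach sz G G :=
  ⟨.skip, _, PolyBounded.const 1, fun i => .skip (G i)⟩

/-- Registers grow by at most the running time (`Exec.bitLength_le`), so straight-line compositions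
need no size estimates of their own. -/
theorem BoundedState.of_reach (hG : BoundedState sz G) (h : PolyReach sz G F) :
    BoundedState sz F := by
  obtain ⟨p, T, hT, hp⟩ := h
  exact fun r => ((hG r).add hT).mono fun i => (hp i).bitLength_le r

theorem PolyReach.const (d : ρ) (z : ℤ) : PolyReach sz G fun i => assign (G i) d z :=
  ⟨.const d z, _, PolyBounded.const (bitLength z), fun i => .const d z (G i)⟩

theorem PolyReach.arith (hG : BoundedState sz G) (o : Op) (d a b : ρ) :
    PolyReach sz G fun i => assign (G i) d (o.eval (G i a) (G i b)) := by
  refine ⟨.arith o d a b, _, ?_, fun i => .arith o d a b (G i)⟩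
  refine (((hG a).add (hG b)).add ((hG a).mul (hG b))).mono fun i => ?_
  cases o <;> simp [Op.cost]

/-- Indexing the body by pairs of an instance and a round forces one program and one polynomial to
serve all rounds; polynomially many rounds then cost polynomial time in total. -/
theorem PolyReach.loop {a : ρ} {n : ι → ℕ} {S : ι → ℕ → ρ → ℤ} (hn : PolyBounded sz n)
    (hpos : ∀ i, ∀ j < n i, 0 < S i j a) (hlast : ∀ i, ¬ 0 < S i (n i) a)
    {c : ι → ℕ} (hc : PolyBounded sz c) (hac : ∀ i, ∀ j ≤ n i, bitLength (S i j a) ≤ c i)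
    (hbody : PolyReach (fun x : Σ i, Fin (n i) => sz x.1) (fun x => S x.1 x.2)
      fun x => S x.1 (x.2 + 1)) :
    PolyReach sz (fun i => S i 0) fun i => S i (n i) := by
  obtain ⟨p, T, ⟨P, hP⟩, hp⟩ := hbody
  have key := fun i => Exec.loop_of_rounds (n i) (S i)
    (fun j => if h : j < n i then T ⟨i, j, h⟩ else 0) (hpos i) (hlast i) (fun j hj => by
      simpa [hj] using hp ⟨i, j, hj⟩)
  refine ⟨.loop a p, _, ?_, key⟩
  refine ((hn.mul (hc.add (PolyBounded.self.eval P))).add hc).mono fun i => ?_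
  refine add_le_add ?_ (hac i _ le_rfl)
  refine (Finset.sum_le_card_nsmul _ _ (c i + P.eval (sz i)) fun j hj => ?_).trans (by simp)
  have hj' := Finset.mem_range.1 hj
  simp only [hj', dif_pos]
  exact add_le_add (hac i j hj'.le) (hP ⟨i, j, hj'⟩)

end Reach

/-! ### Functions computable in polynomial time -/

section Computable

variable {ι : Type*} {𝓡 : Type} {sz : ι → ℕ} {inp : ι → Reg 𝓡 → ℤ} {f g : ι → ℤ}

/-- The functions of the input which can be computed in polynomial time. The work registers are used
as a stack: the value is written to a given work register, and those below it are preserved. -/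
def PolyComputable (sz : ι → ℕ) (inp : ι → Reg 𝓡 → ℤ) (f : ι → ℤ) : Prop :=
  ∀ (m : ℕ) (G : ι → Reg 𝓡 → ℤ), (∀ i r, (∀ j, r ≠ .work j) → G i r = inp i r) →
    BoundedState sz G → ∃ F, PolyReach sz G F ∧ (∀ i, F i (.work m) = f i) ∧
      ∀ i r, (∀ j, m ≤ j → r ≠ .work j) → F i r = G i r

theorem PolyComputable.polyBounded (hf : PolyComputable sz inp f) (hi : BoundedState sz inp) :
    PolyBounded sz fun i => bitLength (f i) := by
  obtain ⟨F, h, hF, -⟩ := hf 0 inp (fun _ _ _ => rfl) hi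
  simpa [hF] using hi.of_reach h (.work 0)

theorem PolyComputable.const (z : ℤ) : PolyComputable sz inp fun _ => z := fun m _ _ _ =>
  ⟨_, PolyReach.const (.work m) z, fun _ => assign_self _ _ _, fun _ _ hr =>
    assign_of_ne _ (hr m le_rfl) _⟩

theorem PolyComputable.op (o : Op) (hf : PolyComputable sz inp f) (hg : PolyComputable sz inp g) :
    PolyComputable sz inp fun i => o.eval (f i) (g i) := by
  intro m G hG hb
  obtain ⟨F, h₁, v₁, k₁⟩ := hf m G hG hb
  have hb₁ := hb.of_reach h₁
  obtain ⟨F', h₂, v₂, k₂⟩ := hg (m + 1) F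
    (fun i r hr => (k₁ i r fun j _ => hr j).trans (hG i r hr)) hb₁
  have hb₂ := hb₁.of_reach h₂
  refine ⟨_, (h₁.trans h₂).trans (PolyReach.arith hb₂ o (.work m) (.work m) (.work (m + 1))),
    fun i => ?_, fun i r hr => ?_⟩
  · rw [assign_self, v₂, k₂ i (.work m) (fun j hj => by simp; omega), v₁]
  · rw [assign_of_ne _ (hr m le_rfl), k₂ i r fun j hj => hr j (by omega), k₁ i r hr]

theorem PolyComputable.reg (r : Reg 𝓡) (hr : ∀ j, r ≠ .work j) :
    PolyComputable sz inp fun i => inp i r := by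
  intro m G hG hb
  -- The machine has no copy instruction, so a register is copied by adding a zero prepared in the
  -- target.
  have hb' := hb.of_reach (PolyReach.const (.work m) 0)
  refine ⟨_, (PolyReach.const (.work m) 0).trans (PolyReach.arith hb' .add (.work m) r (.work m)),
    fun i => ?_, fun i x hx => ?_⟩
  · rw [assign_self, assign_self, assign_of_ne _ (hr m), hG i r hr]
    simp [Op.eval]
  · rw [assign_of_ne _ (hx m le_rfl), assign_of_ne _ (hx m le_rfl)]

theorem PolyComputable.add (hf : PolyComputable sz inp f) (hg : PolyComputable sz inp g) :
    PolyComputable sz inp fun i => f i + g i := hf.op .add hg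

theorem PolyComputable.sub (hf : PolyComputable sz inp f) (hg : PolyComputable sz inp g) :
    PolyComputable sz inp fun i => f i - g i := hf.op .sub hg

theorem PolyComputable.mul (hf : PolyComputable sz inp f) (hg : PolyComputable sz inp g) :
    PolyComputable sz inp fun i => f i * g i := hf.op .mul hg

theorem PolyComputable.div (hf : PolyComputable sz inp f) (hg : PolyComputable sz inp g) :
    PolyComputable sz inp fun i => f i / g i := hf.op .div hg

theorem PolyComputable.prod {α : Type*} (s : Finset α) {φ : α → ι → ℤ}
    (h : ∀ a ∈ s, PolyComputable sz inp (φ a)) : PolyComputable sz inp fun i => ∏ a ∈ s, φ a i := by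
  classical
  induction s using Finset.induction_on with
  | empty => simpa using PolyComputable.const 1
  | insert a s ha ih =>
    simp only [Finset.prod_insert ha]
    exact (h a (by simp)).mul (ih fun b hb => h b (by simp [hb]))

/-- Powers whose exponents have polynomially bounded values. -/
theorem PolyComputable.pow {n : ι → ℕ} (hf : PolyComputable sz inp f)
    (hn : PolyComputable sz inp fun i => (n i : ℤ)) (hbn : PolyBounded sz n) :
    PolyComputable sz inp fun i => f i ^ n i := by
  intro m G hG hb
  obtain ⟨F₁, h₁, v₁, k₁⟩ := hf (m + 1) G hG hb
  have hb₁ := hb.of_reach h₁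
  obtain ⟨F₂, h₂, v₂, k₂⟩ := hn (m + 2) F₁
    (fun i r hr => (k₁ i r fun j _ => hr j).trans (hG i r hr)) hb₁
  have hb₂ := hb₁.of_reach h₂
  have h₃ : PolyReach sz F₂ fun i => assign (F₂ i) (.work m) 1 := .const _ _
  have hb₃ := hb₂.of_reach h₃
  have h₄ : PolyReach sz (fun i => assign (F₂ i) (.work m) 1)
      fun i => assign (assign (F₂ i) (.work m) 1) (.work (m + 3)) 1 := .const _ _
  have hb₄ := hb₃.of_reach h₄
  classical
  -- State after `j` rounds: the accumulator `f ^ j` at `m`, the base at `m + 1`, a counter running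
  -- down from `n` at `m + 2`, and the decrement `1` at `m + 3`.
  let S : ι → ℕ → Reg 𝓡 → ℤ := fun i j =>
    assign (assign (assign (F₂ i) (.work (m + 3)) 1) (.work m) (f i ^ j))
      (.work (m + 2)) (n i - j)
  have hbf : PolyBounded sz fun i => bitLength (f i) := by
    refine (hb₁ (.work (m + 1))).mono fun i => ?_
    rw [v₁]
  have hS0 : (fun i => S i 0) =
      fun i => assign (assign (F₂ i) (.work m) 1) (.work (m + 3)) 1 := by
    funext i r
    simp only [S, assign_apply]
    by_cases hr : r = .work (m + 2)
    · subst hr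
      simp [v₂]
    · by_cases hr' : r = .work m <;> simp [hr, hr']
  have hloop : PolyReach sz (fun i => S i 0) fun i => S i (n i) := by
    refine PolyReach.loop (a := .work (m + 2)) hbn (fun i j hj => ?_) (fun i => ?_)
      (c := fun i => n i + 1) (hbn.add (.const 1)) (fun i j hj => ?_) ?_
    · simp only [S, assign_self]
      omega
    · simp [S, assign_self]
    · simp only [S, assign_self]
      refine le_trans (bitLength_mono ?_) (bitLength_natCast_le (n i))
      omega
    -- The closed form of each state bounds its registers directly; a growth estimate compounded
    -- over the rounds would not stay polynomial.
    · have hbS : BoundedState (fun x : Σ i, Fin (n i) => sz x.1) fun x => S x.1 x.2 := by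
        intro r
        simp only [S, assign_apply]
        have e₁ := (hbn.add (.const 1)).comp (Sigma.fst : (Σ i, Fin (n i)) → ι)
        have e₂ := ((hbn.mul hbf).add (.const 2)).comp (Sigma.fst : (Σ i, Fin (n i)) → ι)
        have e₃ := (hb₂ r).comp (Sigma.fst : (Σ i, Fin (n i)) → ι)
        refine ((e₁.add e₂).add (e₃.add (.const (bitLength 1)))).mono fun x => ?_
        have hx := x.2.2
        have i₁ : bitLength ((n x.1 : ℤ) - (x.2 : ℕ)) ≤ n x.1 + 1 := by
          refine le_trans (bitLength_mono ?_) (bitLength_natCast_le _)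
          omega
        have i₂ : bitLength (f x.1 ^ (x.2 : ℕ)) ≤ n x.1 * bitLength (f x.1) + 2 := by
          refine (bitLength_pow_le _ _).trans ?_
          gcongr
        split_ifs <;> omega
      have s₁ := PolyReach.arith hbS .mul (.work m) (.work m) (.work (m + 1))
      have s₂ := PolyReach.arith (hbS.of_reach s₁) .sub (.work (m + 2)) (.work (m + 2))
        (.work (m + 3))
      convert s₁.trans s₂ using 1
      funext x r
      have hv : F₂ x.1 (.work (m + 1)) = f x.1 := by
        rw [k₂ _ _ fun j hj => by simp; omega, v₁]
      simp only [S, assign_apply, Op.eval]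
      by_cases hr : r = .work (m + 2)
      · subst hr
        simp
        ring
      · by_cases hr' : r = .work m
        · subst hr'
          simp [hv, pow_succ]
        · simp [hr, hr']
  rw [hS0] at hloop
  refine ⟨_, (((h₁.trans h₂).trans h₃).trans h₄).trans hloop, fun i => ?_, fun i r hr => ?_⟩
  · simp [S, assign_apply]
  · have := hr m le_rfl
    have := hr (m + 2) (by omega)
    have := hr (m + 3) (by omega)
    simp only [S, assign_apply, *, if_false]
    rw [k₂ i r fun j hj => hr j (by omega), k₁ i r fun j hj => hr j (by omega)]

/-- Lays out the arguments of a subroutine in consecutive work registers. -/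
theorem PolyComputable.list {α : Type*} {φ : α → ι → ℤ} (h : ∀ a, PolyComputable sz inp (φ a))
    (l : List α) : ∀ (m : ℕ) (G : ι → Reg 𝓡 → ℤ),
      (∀ i r, (∀ j, r ≠ .work j) → G i r = inp i r) → BoundedState sz G →
      ∃ F, PolyReach sz G F ∧ (∀ i k (hk : k < l.length), F i (.work (m + k)) = φ l[k] i) ∧
        ∀ i r, (∀ j, m ≤ j → r ≠ .work j) → F i r = G i r := by
  induction l with
  | nil => exact fun m G _ _ => ⟨G, .refl, by simp, fun _ _ _ => rfl⟩
  | cons a l ih =>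
    intro m G hG hb
    obtain ⟨F₁, h₁, v₁, k₁⟩ := h a m G hG hb
    obtain ⟨F₂, h₂, v₂, k₂⟩ := ih (m + 1) F₁
      (fun i r hr => (k₁ i r fun j _ => hr j).trans (hG i r hr)) (hb.of_reach h₁)
    refine ⟨F₂, h₁.trans h₂, fun i k hk => ?_, fun i r hr => ?_⟩
    · cases k with
      | zero => simpa using (k₂ i (.work m) fun j hj => by simp; omega).trans (v₁ i)
      | succ k =>
        have := v₂ i k (by simpa using hk)
        rw [show m + 1 + k = m + (k + 1) by omega] at this
        simpa using this
    · rw [k₂ i r fun j hj => hr j (by omega), k₁ i r hr]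

/-- Calls of a subroutine. -/
theorem PolyComputable.call {ρ : Type} {p : Prog ρ} {s s' : ι → ρ → ℤ} {T : ι → ℕ}
    (hT : PolyBounded sz T) (hp : ∀ i, Exec p (s i) (s' i) (T i))
    (hs : ∀ r, PolyComputable sz inp fun i => s i r) (r : ρ) :
    PolyComputable sz inp fun i => s' i r := by
  classical
  intro m G hG hb
  -- Only finitely many registers occur in `p`; each is moved to the work register given by its
  -- position in the list `l`. `r` is added because the result may be read from a register that `p`
  -- never mentions.
  have hU : (insert r p.regs).Finite := p.finite_regs.insert r
  set l := hU.toFinset.toList with hl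
  have hmem : ∀ x, x ∈ l ↔ x ∈ insert r p.regs := fun x => by simp [hl]
  obtain ⟨F, h₁, v₁, k₁⟩ := PolyComputable.list hs l m G hG hb
  have hb₁ := hb.of_reach h₁
  have hinj : (insert r p.regs).InjOn fun x => (Reg.work (m + l.idxOf x) : Reg 𝓡) := by
    intro x hx y hy hxy
    simp only [Reg.work.injEq, add_right_inj] at hxy
    exact (List.idxOf_inj ((hmem x).2 hx)).1 hxy
  have hF : ∀ i, ∀ x ∈ insert r p.regs, F i (.work (m + l.idxOf x)) = s i x := by
    intro i x hx
    have := List.idxOf_lt_length_iff.2 ((hmem x).2 hx)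
    rw [v₁ i _ this, List.getElem_idxOf]
  choose F' e₂ v₂ k₂ using fun i =>
    (hp i).map hinj (Set.subset_insert r p.regs) (F i) (hF i)
  have h₂ : PolyReach sz F F' := ⟨_, T, hT, e₂⟩
  have hb₂ := hb₁.of_reach h₂
  have hlr := List.idxOf_lt_length_iff.2 ((hmem r).2 (Set.mem_insert r _))
  have h₃ : PolyReach sz F' fun i => assign (F' i) (.work (m + l.length)) 0 := .const _ _
  have h₄ := PolyReach.arith (hb₂.of_reach h₃) .add (.work m) (.work (m + l.idxOf r))
    (.work (m + l.length))
  refine ⟨_, ((h₁.trans h₂).trans h₃).trans h₄, fun i => ?_, fun i x hx => ?_⟩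
  · rw [assign_self, assign_self, assign_of_ne _ (by simp; omega), v₂ i r (Set.mem_insert r _)]
    simp [Op.eval]
  · rw [assign_of_ne _ (hx m le_rfl), assign_of_ne _ (hx _ (Nat.le_add_right _ _)), k₂, k₁ i x hx]
    rintro ⟨y, -, rfl⟩
    exact hx _ (Nat.le_add_right _ _) rfl

end Computable

/-! ### Satisfaction of combined sentences -/

section Models

variable {𝓡 : Type} {arity : 𝓡 → ℕ} {C Δ : Type} {c : C → Δ} {ω : World arity Δ}
  {Γ Γ' : (lang arity C).Sentence}

theorem models_bot : ¬ Models c ω (⊥ : (lang arity C).Sentence) := id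

theorem models_top : Models c ω (⊤ : (lang arity C).Sentence) := id

theorem models_not : Models c ω Γ.not ↔ ¬ Models c ω Γ := Iff.rfl

theorem models_inf : Models c ω (Γ ⊓ Γ') ↔ Models c ω Γ ∧ Models c ω Γ' :=
  @Language.Formula.realize_inf (lang arity C) Δ (toStructure c ω) _ _ _ _

theorem models_sup : Models c ω (Γ ⊔ Γ') ↔ Models c ω Γ ∨ Models c ω Γ' :=
  @Language.Formula.realize_sup (lang arity C) Δ (toStructure c ω) _ _ _ _

theorem models_imp : Models c ω (Γ.imp Γ') ↔ (Models c ω Γ → Models c ω Γ') :=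
  @Language.Formula.realize_imp (lang arity C) Δ (toStructure c ω) _ _ _ _

theorem models_iff : Models c ω (Γ.iff Γ') ↔ (Models c ω Γ ↔ Models c ω Γ') :=
  @Language.Formula.realize_iff (lang arity C) Δ (toStructure c ω) _ _ _ _

theorem models_toSentence (κ : CardConstraint 𝓡) :
    Models c ω (κ.toSentence : (lang arity C).Sentence) ↔ κ.Holds ω :=
  @Language.Formula.realize_rel (lang arity C) Δ (toStructure c ω) _ _ _ (RelSym.card κ) _

theorem models_subst {V : Type} (σ : V → (lang arity C).Sentence) (ψ : PropFormula V) :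
    Models c ω (ψ.subst σ) ↔ ψ.Holds fun x => Models c ω (σ x) := by
  induction ψ with
  | var x => rfl
  | false => rfl
  | not φ ih => exact models_not.trans (not_congr ih)
  | and φ χ ih ih' => exact models_inf.trans (and_congr ih ih')
  | or φ χ ih ih' => exact models_sup.trans (or_congr ih ih')
  | imp φ χ ih ih' => exact models_imp.trans (imp_congr ih ih')
  | iff φ χ ih ih' => exact models_iff.trans (iff_congr ih ih')

end Models

/-! ### Weights of worlds -/

section Weights

variable {𝓡 : Type} [Fintype 𝓡] {arity : 𝓡 → ℕ} {C Δ : Type} [Fintype Δ]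
  {K : Type} [CommSemiring K] (c : C → Δ) (Γ : (lang arity C).Sentence) (w wbar : 𝓡 → K)

omit [Fintype 𝓡] in
theorem card_le (R : 𝓡) (ω : World arity Δ) : card R ω ≤ Fintype.card Δ ^ arity R := by
  classical
  refine (Set.ncard_le_card _).trans ?_
  simp

/-- The weight of a possible world. -/
noncomputable def worldWeight (ω : World arity Δ) : K :=
  ∏ R : 𝓡, w R ^ card R ω * wbar R ^ (Fintype.card Δ ^ arity R - card R ω)

open Classical in
theorem wfomc_eq_sum :
    wfomc c Γ w wbar = ∑ ω : World arity Δ, if Models c ω Γ then worldWeight w wbar ω else 0 := by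
  simp [wfomc, wfomcOn, worldWeight, Finset.sum_filter]

open Classical in
theorem wfomcOn_eq_sum (Ω : Set (World arity Δ)) :
    wfomcOn c Γ w wbar Ω =
      ∑ ω : World arity Δ, if ω ∈ Ω ∧ Models c ω Γ then worldWeight w wbar ω else 0 := by
  simp [wfomcOn, worldWeight, Finset.sum_filter]

open Classical in
theorem worldWeight_update (R : 𝓡) (x : K) (ω : World arity Δ) :
    worldWeight (Function.update w R (w R * x)) wbar ω = worldWeight w wbar ω * x ^ card R ω := by
  have : ∀ R' : 𝓡, Function.update w R (w R * x) R' ^ card R' ω *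
      wbar R' ^ (Fintype.card Δ ^ arity R' - card R' ω) =
      (w R' ^ card R' ω * wbar R' ^ (Fintype.card Δ ^ arity R' - card R' ω)) *
        if R' = R then x ^ card R ω else 1 := by
    intro R'
    by_cases h : R' = R
    · subst h
      simp [mul_pow]
      ring
    · simp [h]
  simp only [worldWeight, this, Finset.prod_mul_distrib]
  simp

open Classical in
/-- Scaling the weight of a predicate turns the WFOMC into a polynomial, whose coefficients are the
weighted counts of the models with a given cardinality of that predicate. -/
theorem wfomc_update (R : 𝓡) (x : K) :
    wfomc c Γ (Function.update w R (w R * x)) wbar =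
      ∑ j ∈ Finset.range (Fintype.card Δ ^ arity R + 1),
        wfomcOn c Γ w wbar {ω | card R ω = j} * x ^ j := by
  simp only [wfomc_eq_sum, wfomcOn_eq_sum, Finset.sum_mul]
  rw [Finset.sum_comm]
  refine Finset.sum_congr rfl fun ω _ => ?_
  rw [Finset.sum_eq_single (card R ω)]
  · simp [worldWeight_update]
  · intro j _ hj
    simp [hj.symm]
  · intro h
    exact absurd (Finset.mem_range.2 (Nat.lt_succ_of_le (card_le R ω))) h

-- Supplies the vanishing of high digits that digit extraction needs.
open Classical in
theorem wfomcOn_card_eq_zero (R : 𝓡) {j : ℕ} (hj : Fintype.card Δ ^ arity R < j) :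
    wfomcOn c Γ w wbar {ω | card R ω = j} = 0 := by
  rw [wfomcOn_eq_sum]
  refine Finset.sum_eq_zero fun ω _ => if_neg ?_
  rintro ⟨h, -⟩
  have := card_le R ω
  rw [Set.mem_ofPred_eq] at h
  omega

end Weights

/-! ### Denominators and sizes of the weighted counts -/

section Rational

variable {𝓡 : Type} [Fintype 𝓡] {arity : 𝓡 → ℕ} {C Δ : Type} [Fintype Δ]
  (c : C → Δ) (Γ : (lang arity C).Sentence) (w wbar : 𝓡 → ℚ)

/-- An upper bound for twice the size of the weights, and a multiple of their denominators. -/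
def weightScale : ℤ :=
  ∏ R : 𝓡, ((w R).den * (wbar R).den * (2 * ((w R).num * (w R).num +
    (wbar R).num * (wbar R).num + 1)))

theorem exists_int_den_pow_mul_pow (q : ℚ) {n E : ℕ} (h : n ≤ E) :
    ∃ z : ℤ, (q.den : ℚ) ^ E * q ^ n = z := by
  refine ⟨(q.den : ℤ) ^ (E - n) * q.num ^ n, ?_⟩
  obtain ⟨k, rfl⟩ := Nat.exists_eq_add_of_le h
  push_cast
  rw [Nat.add_sub_cancel_left, pow_add, mul_right_comm, ← mul_pow, Rat.den_mul_eq_num, mul_comm]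

theorem exists_int_weightScale_mul_worldWeight {E : ℕ}
    (hE : ∀ R, Fintype.card Δ ^ arity R ≤ E) (ω : World arity Δ) :
    ∃ z : ℤ, (weightScale w wbar : ℚ) ^ E * worldWeight w wbar ω = z := by
  have h : ∀ R, ∃ z : ℤ, (((w R).den * (wbar R).den * (2 * ((w R).num * (w R).num +
      (wbar R).num * (wbar R).num + 1)) : ℤ) : ℚ) ^ E *
      (w R ^ card R ω * wbar R ^ (Fintype.card Δ ^ arity R - card R ω)) = z := by
    intro R
    obtain ⟨a, ha⟩ := exists_int_den_pow_mul_pow (w R) ((card_le R ω).trans (hE R))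
    obtain ⟨b, hb⟩ := exists_int_den_pow_mul_pow (wbar R)
      (((Fintype.card Δ ^ arity R).sub_le (card R ω)).trans (hE R))
    refine ⟨a * b * (2 * ((w R).num * (w R).num + (wbar R).num * (wbar R).num + 1)) ^ E, ?_⟩
    push_cast
    rw [← ha, ← hb, mul_pow, mul_pow]
    ring
  choose z hz using h
  refine ⟨∏ R, z R, ?_⟩
  rw [weightScale, worldWeight, Int.cast_prod, ← Finset.prod_pow, ← Finset.prod_mul_distrib,
    Int.cast_prod]
  exact Finset.prod_congr rfl fun R _ => hz R

theorem exists_int_weightScale_mul_wfomcOn {E : ℕ}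
    (hE : ∀ R, Fintype.card Δ ^ arity R ≤ E) (Ω : Set (World arity Δ)) :
    ∃ z : ℤ, (weightScale w wbar : ℚ) ^ E * wfomcOn c Γ w wbar Ω = z := by
  classical
  choose z hz using exists_int_weightScale_mul_worldWeight (Δ := Δ) w wbar hE
  refine ⟨∑ ω : World arity Δ, if ω ∈ Ω ∧ Models c ω Γ then z ω else 0, ?_⟩
  rw [wfomcOn_eq_sum, Finset.mul_sum]
  push_cast
  refine Finset.sum_congr rfl fun ω _ => ?_
  split_ifs
  · exact hz ω
  · simp

/-- Using the square of the numerator instead of its absolute value makes `weightScale` a purely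
arithmetic expression in the input registers. -/
theorem abs_rat_le_num_sq (q : ℚ) : |q| ≤ (q.num : ℚ) * q.num := by
  have h1 : |q| ≤ |(q.num : ℚ)| := by
    conv_lhs => rw [← Rat.num_div_den q]
    rw [abs_div, Nat.abs_cast]
    exact div_le_self (abs_nonneg _) (by exact_mod_cast q.pos)
  refine h1.trans ?_
  rw [← Int.cast_abs, ← Int.cast_mul]
  have : |q.num| ≤ q.num * q.num := by
    rw [← abs_mul_abs_self]
    rcases (abs_nonneg q.num).eq_or_lt with h | h
    · simp [← h]
    · exact le_mul_of_one_le_left h.le h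
  exact_mod_cast this

theorem one_le_weightScale : 1 ≤ weightScale w wbar := by
  refine Int.add_one_le_iff.2 (Finset.prod_pos fun R _ => ?_)
  have := (w R).pos
  have := (wbar R).pos
  have := mul_self_nonneg (w R).num
  have := mul_self_nonneg (wbar R).num
  positivity

theorem card_world : Fintype.card (World arity Δ) = ∏ R, 2 ^ (Fintype.card Δ ^ arity R) := by
  classical
  rw [← Nat.card_eq_fintype_card]
  simp [Finset.prod_pow_eq_pow_sum, Nat.card_eq_fintype_card, World, Fintype.card_set]

/-- For each predicate the base dominates both weights, and the exponents of true and false atoms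
add up to the number of ground atoms. -/
theorem abs_worldWeight_le (ω : World arity Δ) :
    |worldWeight w wbar ω| ≤ ∏ R, ((w R).num * (w R).num + (wbar R).num * (wbar R).num + 1 : ℚ) ^
      (Fintype.card Δ ^ arity R) := by
  rw [worldWeight, Finset.abs_prod]
  refine Finset.prod_le_prod (fun _ _ => abs_nonneg _) fun R _ => ?_
  have h₁ := abs_rat_le_num_sq (w R)
  have h₂ := abs_rat_le_num_sq (wbar R)
  have h₃ := mul_self_nonneg ((w R).num : ℚ)
  have h₄ := mul_self_nonneg ((wbar R).num : ℚ)
  have h := pow_add ((w R).num * (w R).num + (wbar R).num * (wbar R).num + 1 : ℚ) (card R ω)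
    (Fintype.card Δ ^ arity R - card R ω)
  rw [Nat.add_sub_cancel' (card_le R ω)] at h
  rw [h, abs_mul, abs_pow, abs_pow]
  gcongr <;> linarith

/-- Bound the sum by the number of worlds times the largest weight. The factor `2` in `weightScale`
pays for the two choices per ground atom. -/
theorem abs_wfomcOn_le {E : ℕ} (hE : ∀ R, Fintype.card Δ ^ arity R ≤ E)
    (Ω : Set (World arity Δ)) :
    |wfomcOn c Γ w wbar Ω| ≤ (weightScale w wbar : ℚ) ^ E := by
  classical
  rw [wfomcOn_eq_sum]
  refine (Finset.abs_sum_le_sum_abs _ _).trans ?_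
  refine (Finset.sum_le_card_nsmul _ _ (∏ R, ((w R).num * (w R).num +
    (wbar R).num * (wbar R).num + 1 : ℚ) ^ (Fintype.card Δ ^ arity R)) fun ω _ => ?_).trans ?_
  · split_ifs
    · exact abs_worldWeight_le w wbar ω
    · rw [abs_zero]
      refine Finset.prod_nonneg fun R _ => pow_nonneg ?_ _
      nlinarith [mul_self_nonneg ((w R).num : ℚ), mul_self_nonneg ((wbar R).num : ℚ)]
  · rw [Finset.card_univ, card_world, nsmul_eq_mul, Nat.cast_prod, ← Finset.prod_mul_distrib,
      weightScale, Int.cast_prod, ← Finset.prod_pow]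
    refine Finset.prod_le_prod (fun R _ => ?_) fun R _ => ?_
    · have := mul_self_nonneg ((w R).num : ℚ)
      have := mul_self_nonneg ((wbar R).num : ℚ)
      positivity
    · have h₁ := mul_self_nonneg ((w R).num : ℚ)
      have h₂ := mul_self_nonneg ((wbar R).num : ℚ)
      have h₃ : (1 : ℚ) ≤ (w R).den * (wbar R).den := by
        exact_mod_cast Nat.mul_pos (w R).pos (wbar R).pos
      have h₄ : (0 : ℚ) ≤ 2 * ((w R).num * (w R).num + (wbar R).num * (wbar R).num + 1) := by
        positivity
      push_cast
      rw [← mul_pow]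
      refine (pow_le_pow_right₀ (by linarith) (hE R)).trans ?_
      exact pow_le_pow_left₀ h₄ (le_mul_of_one_le_left h₄ h₃) _

end Rational

/-! ### Reading off signed digits -/

/-- The number `V` without its last `j` signed digits to the base `X`, where signed digits lie
between `-h` and `h`. -/
def dropDigits (V h X : ℤ) : ℕ → ℤ
  | 0 => V
  | j + 1 => (dropDigits V h X j + h) / X

/-- The signed digit at position `j`. -/
def signedDigit (V h X : ℤ) (j : ℕ) : ℤ := dropDigits V h X j - X * dropDigits V h X (j + 1)

/-- Adding `h` moves the lowest digit into `[0, 2h]`, below `X`, so floor division removes exactly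
that digit. Since `b` vanishes beyond `M`, the range of summation can stay fixed while the digits
shift. -/
theorem dropDigits_sum {b : ℕ → ℤ} {h X : ℤ} {M : ℕ} (hb : ∀ l, |b l| ≤ h) (hX : 2 * h < X)
    (hM : ∀ l, M < l → b l = 0) (j : ℕ) :
    dropDigits (∑ l ∈ Finset.range (M + 1), b l * X ^ l) h X j =
      ∑ l ∈ Finset.range (M + 1), b (j + l) * X ^ l := by
  induction j with
  | zero => simp [dropDigits]
  | succ j ih =>
    rw [dropDigits, ih, Finset.sum_range_succ', Finset.sum_range_succ]
    rw [hM (j + 1 + M) (by omega)]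
    have h₁ := abs_le.1 (hb j)
    have hX0 : 0 < X := by linarith [(abs_nonneg _).trans (hb j)]
    have : ∑ k ∈ Finset.range M, b (j + (k + 1)) * X ^ (k + 1) + b (j + 0) * X ^ 0 + h =
        (b j + h) + X * ∑ k ∈ Finset.range M, b (j + 1 + k) * X ^ k := by
      rw [Finset.mul_sum, pow_zero, mul_one, add_zero, add_assoc, add_comm]
      congr 1
      refine Finset.sum_congr rfl fun k _ => ?_
      rw [show j + (k + 1) = j + 1 + k by omega, pow_succ]
      ring
    rw [this, Int.add_mul_ediv_left _ _ hX0.ne', Int.ediv_eq_zero_of_lt (by linarith) (by linarith)]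
    simp

theorem signedDigit_sum {b : ℕ → ℤ} {h X : ℤ} {M : ℕ} (hb : ∀ l, |b l| ≤ h) (hX : 2 * h < X)
    (hM : ∀ l, M < l → b l = 0) (j : ℕ) :
    signedDigit (∑ l ∈ Finset.range (M + 1), b l * X ^ l) h X j = b j := by
  rw [signedDigit, dropDigits_sum hb hX hM, dropDigits_sum hb hX hM, Finset.sum_range_succ',
    Finset.sum_range_succ _ M, hM (j + 1 + M) (by omega), mul_add, Finset.mul_sum]
  simp only [pow_zero, mul_one, zero_mul, mul_zero, add_zero]
  rw [add_comm, add_sub_assoc, add_eq_left, sub_eq_zero]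
  refine Finset.sum_congr rfl fun k _ => ?_
  rw [show j + (k + 1) = j + 1 + k by omega, pow_succ]
  ring

/-! ### Values computable from a domain and weights -/

/-- The data on which a WFOMC is computed. -/
structure Instance (𝓡 C : Type) where
  Δ : Type
  [fintype : Fintype Δ]
  c : C ↪ Δ
  w : 𝓡 → ℚ
  wbar : 𝓡 → ℚ

attribute [instance] Instance.fintype

section Liftable

variable {𝓡 : Type} [Fintype 𝓡] {arity : 𝓡 → ℕ} {C : Type}

/-- The size of the domain plus the number of bits needed to represent the weights. -/
def Instance.size (I : Instance 𝓡 C) : ℕ := Fintype.card I.Δ + weightBits I.w I.wbar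

omit [Fintype 𝓡] in
/-- The register contents at the start. -/
def Instance.input (I : Instance 𝓡 C) : Reg 𝓡 → ℤ :=
  WFOMC.input (Fintype.card I.Δ) I.w I.wbar

/-- Integer-valued functions of the domain and the weights which are computable in polynomial
time. -/
abbrev Computable (f : Instance 𝓡 C → ℤ) : Prop :=
  PolyComputable Instance.size Instance.input f

theorem polyBounded_card :
    PolyBounded (Instance.size (𝓡 := 𝓡) (C := C)) fun I => Fintype.card I.Δ :=
  PolyBounded.self.mono fun _ => Nat.le_add_right _ _

theorem boundedState_input :
    BoundedState (Instance.size (𝓡 := 𝓡) (C := C)) Instance.input := by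
  have hbits : ∀ (I : Instance 𝓡 C) (R : 𝓡),
      ratBits (I.w R) + ratBits (I.wbar R) ≤ I.size := fun I R =>
    (Finset.single_le_sum (f := fun R => ratBits (I.w R) + ratBits (I.wbar R))
      (fun _ _ => Nat.zero_le _) (Finset.mem_univ R)).trans (Nat.le_add_left _ _)
  intro r
  refine (PolyBounded.self.add (.const 1)).mono fun I => ?_
  have h0 : bitLength 0 = 1 := by simp [bitLength]
  cases r with
  | size => exact (bitLength_natCast_le _).trans (by simp [Instance.size])
  | wNum R =>
    have := hbits I R
    simp only [ratBits] at this
    simp only [Instance.input, input]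
    omega
  | wDen R =>
    have := hbits I R
    simp only [ratBits] at this
    simp only [Instance.input, input]
    omega
  | wbarNum R =>
    have := hbits I R
    simp only [ratBits] at this
    simp only [Instance.input, input]
    omega
  | wbarDen R =>
    have := hbits I R
    simp only [ratBits] at this
    simp only [Instance.input, input]
    omega
  | outNum => simp only [Instance.input, input]; omega
  | outDen => simp only [Instance.input, input]; omega
  | work j => simp only [Instance.input, input]; omega

/-- Rational-valued functions of the domain and the weights which are computable, as fractions, in
polynomial time. -/
def RatComputable (v : Instance 𝓡 C → ℚ) : Prop :=
  ∃ p q : Instance 𝓡 C → ℤ, Computable p ∧ Computable q ∧ ∀ I, q I ≠ 0 ∧ (p I / q I : ℚ) = v I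

theorem RatComputable.add {u v : Instance 𝓡 C → ℚ} (hu : RatComputable u)
    (hv : RatComputable v) : RatComputable fun I => u I + v I := by
  obtain ⟨p, q, hp, hq, h⟩ := hu
  obtain ⟨p', q', hp', hq', h'⟩ := hv
  refine ⟨_, _, (hp.mul hq').add (hq.mul hp'), hq.mul hq', fun I =>
    ⟨mul_ne_zero (h I).1 (h' I).1, ?_⟩⟩
  change _ = u I + v I
  rw [← (h I).2, ← (h' I).2, div_add_div _ _ (Int.cast_ne_zero.2 (h I).1)
    (Int.cast_ne_zero.2 (h' I).1)]
  push_cast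
  rfl

theorem RatComputable.sub {u v : Instance 𝓡 C → ℚ} (hu : RatComputable u)
    (hv : RatComputable v) : RatComputable fun I => u I - v I := by
  obtain ⟨p, q, hp, hq, h⟩ := hu
  obtain ⟨p', q', hp', hq', h'⟩ := hv
  refine ⟨_, _, (hp.mul hq').sub (hq.mul hp'), hq.mul hq', fun I =>
    ⟨mul_ne_zero (h I).1 (h' I).1, ?_⟩⟩
  change _ = u I - v I
  rw [← (h I).2, ← (h' I).2, div_sub_div _ _ (Int.cast_ne_zero.2 (h I).1)
    (Int.cast_ne_zero.2 (h' I).1)]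
  push_cast
  rfl

theorem RatComputable.sum {α : Type*} (s : Finset α) {v : α → Instance 𝓡 C → ℚ}
    (h : ∀ a, RatComputable (v a)) : RatComputable fun I => ∑ a ∈ s, v a I := by
  classical
  induction s using Finset.induction_on with
  | empty => exact ⟨_, _, .const 0, .const 1, by simp⟩
  | insert a s ha ih =>
    simp only [Finset.sum_insert ha]
    exact (h a).add ih

/-- The output of an algorithm for the WFOMC of `Γ`, called on computable instances. -/
theorem DomainLiftable.call {Γ : (lang arity C).Sentence} (hΓ : DomainLiftable Γ)
    (e : Instance 𝓡 C → Instance 𝓡 C) (he : PolyBounded Instance.size fun I => (e I).size)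
    (hi : ∀ r, Computable fun I => (e I).input r) :
    RatComputable fun I => wfomc (e I).c Γ (e I).w (e I).wbar := by
  obtain ⟨A, P, h⟩ := hΓ
  choose s t hA ht hden hval using fun I : Instance 𝓡 C => h I.Δ I.c I.w I.wbar
  have hT : PolyBounded Instance.size fun I => t (e I) :=
    (he.eval P).mono fun I => ht (e I)
  have hs := PolyComputable.call hT (fun I => hA (e I)) hi
  exact ⟨_, _, hs .outNum, hs .outDen, fun I => ⟨hden (e I), hval (e I)⟩⟩

/-- Replaces the machine by a class with closure properties: left to right is a call on the
unchanged instance, right to left copies numerator and denominator to the output registers. -/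
theorem domainLiftable_iff {Γ : (lang arity C).Sentence} :
    DomainLiftable Γ ↔ RatComputable fun I : Instance 𝓡 C => wfomc I.c Γ I.w I.wbar := by
  classical
  constructor
  · intro hΓ
    refine hΓ.call id .self fun r => ?_
    cases r with
    | work j => exact .const 0
    | _ => exact .reg _ (by simp)
  · rintro ⟨p, q, hp, hq, h⟩
    obtain ⟨F₁, h₁, v₁, k₁⟩ := hp 0 Instance.input (fun _ _ _ => rfl) boundedState_input
    have hb₁ := boundedState_input.of_reach h₁
    obtain ⟨F₂, h₂, v₂, k₂⟩ := hq 1 F₁ (fun I r hr => k₁ I r fun j _ => hr j) hb₁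
    have hb₂ := hb₁.of_reach h₂
    have h₃ : PolyReach Instance.size F₂ fun I => assign (F₂ I) (.work 2) 0 := .const _ _
    have hb₃ := hb₂.of_reach h₃
    have h₄ := PolyReach.arith hb₃ .add .outNum (.work 0) (.work 2)
    have h₅ := PolyReach.arith (hb₃.of_reach h₄) .add .outDen (.work 1) (.work 2)
    obtain ⟨A, T, ⟨P, hP⟩, hA⟩ := (((h₁.trans h₂).trans h₃).trans h₄).trans h₅
    refine ⟨A, P, fun Δ _ c w wbar => ?_⟩
    have hA' := hA ⟨Δ, c, w, wbar⟩
    have h' := h ⟨Δ, c, w, wbar⟩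
    have e₁ : F₂ ⟨Δ, c, w, wbar⟩ (.work 0) = p ⟨Δ, c, w, wbar⟩ := by
      rw [k₂ _ _ fun j hj => by simp; omega, v₁]
    refine ⟨_, _, hA', hP _, ?_, ?_⟩
    · simpa [assign_apply, Op.eval, v₂] using h'.1
    · simpa [assign_apply, Op.eval, v₂, e₁] using h'.2

end Liftable

/-! ### Cardinality constraints -/

section Constraint

variable {𝓡 : Type} [Fintype 𝓡] {arity : 𝓡 → ℕ} {C : Type} {Γ : (lang arity C).Sentence}

theorem computable_weightScale :
    Computable fun I : Instance 𝓡 C => weightScale I.w I.wbar := by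
  have hw : ∀ R, Computable fun I : Instance 𝓡 C => (I.w R).num := fun R => .reg (.wNum R) (by simp)
  have hd : ∀ R, Computable fun I : Instance 𝓡 C => ((I.w R).den : ℤ) :=
    fun R => .reg (.wDen R) (by simp)
  have hw' : ∀ R, Computable fun I : Instance 𝓡 C => (I.wbar R).num :=
    fun R => .reg (.wbarNum R) (by simp)
  have hd' : ∀ R, Computable fun I : Instance 𝓡 C => ((I.wbar R).den : ℤ) :=
    fun R => .reg (.wbarDen R) (by simp)
  exact .prod _ fun R _ => ((hd R).mul (hd' R)).mul
    ((PolyComputable.const 2).mul ((((hw R).mul (hw R)).add ((hw' R).mul (hw' R))).add (.const 1)))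

/-- An upper bound for the numbers of ground atoms of the predicates. -/
def Instance.atomBound (arity : 𝓡 → ℕ) (I : Instance 𝓡 C) : ℕ :=
  (Fintype.card I.Δ + 1) ^ ∑ R, arity R

/-- The base is one more than the domain size so that powers are monotone in the exponent even on
the empty domain. -/
theorem Instance.card_pow_le_atomBound (I : Instance 𝓡 C) (R : 𝓡) :
    Fintype.card I.Δ ^ arity R ≤ I.atomBound arity :=
  (Nat.pow_le_pow_left (Nat.le_succ _) _).trans (Nat.pow_le_pow_right (Nat.succ_pos _)
    (Finset.single_le_sum (fun _ _ => Nat.zero_le _) (Finset.mem_univ R)))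

theorem polyBounded_atomBound :
    PolyBounded (Instance.size (𝓡 := 𝓡) (C := C)) (Instance.atomBound arity) :=
  (polyBounded_card.add (.const 1)).pow _

/-- A common denominator of the weighted counts, which also bounds their size. -/
def Instance.denom (arity : 𝓡 → ℕ) (I : Instance 𝓡 C) : ℤ :=
  weightScale I.w I.wbar ^ I.atomBound arity

theorem Instance.one_le_denom (I : Instance 𝓡 C) : 1 ≤ I.denom arity :=
  one_le_pow₀ (one_le_weightScale _ _)

theorem computable_denom : Computable (Instance.denom (C := C) arity) := by
  refine computable_weightScale.pow ?_ polyBounded_atomBound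
  have hc : Computable fun I : Instance 𝓡 C => ((Fintype.card I.Δ : ℕ) : ℤ) :=
    .reg .size (by simp)
  simp only [Instance.atomBound]
  push_cast
  exact (hc.add (.const 1)).pow (.const _) (.const _)

/-- The factor by which the numerator of a weight is scaled. -/
def Instance.numScale (arity : 𝓡 → ℕ) (I : Instance 𝓡 C) : ℤ :=
  2 * (I.denom arity * I.denom arity) + 1

theorem computable_numScale : Computable (Instance.numScale (C := C) arity) :=
  ((PolyComputable.const 2).mul (computable_denom.mul computable_denom)).add (.const 1)

open Classical in
/-- The instance in which the weight of `R` is scaled by `(I.w R).den * I.numScale arity`. -/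
noncomputable def Instance.scale (arity : 𝓡 → ℕ) (R : 𝓡) (I : Instance 𝓡 C) : Instance 𝓡 C :=
  { I with w := Function.update I.w R (I.w R * ((I.w R).den * I.numScale arity : ℤ)) }

/-- The denominator in the scaling factor makes the new weight an integer, so its reduced fraction
is obtained without computing a gcd. -/
theorem Instance.scale_w_self (R : 𝓡) (I : Instance 𝓡 C) :
    (I.scale arity R).w R = ((I.w R).num * I.numScale arity : ℤ) := by
  simp only [Instance.scale, Function.update_self]
  push_cast
  rw [← mul_assoc, Rat.mul_den_eq_num]

theorem Instance.scale_w_of_ne {R R' : 𝓡} (h : R' ≠ R) (I : Instance 𝓡 C) :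
    (I.scale arity R).w R' = I.w R' := by
  simp [Instance.scale, h]

theorem computable_scale_input (R : 𝓡) (r : Reg 𝓡) :
    Computable fun I : Instance 𝓡 C => (I.scale arity R).input r := by
  cases r with
  | size => exact .reg .size (by simp)
  | wbarNum R' => exact .reg (.wbarNum R') (by simp)
  | wbarDen R' => exact .reg (.wbarDen R') (by simp)
  | outNum => exact .const 0
  | outDen => exact .const 0
  | work j => exact .const 0
  | wNum R' =>
    simp only [Instance.input, input]
    by_cases h : R' = R
    · subst h
      simp only [Instance.scale_w_self, Rat.num_intCast]
      exact (PolyComputable.reg (.wNum R') (by simp)).mul computable_numScale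
    · simp only [Instance.scale_w_of_ne h]
      exact .reg (.wNum R') (by simp)
  | wDen R' =>
    simp only [Instance.input, input]
    by_cases h : R' = R
    · subst h
      simp only [Instance.scale_w_self, Rat.den_intCast]
      exact .const 1
    · simp only [Instance.scale_w_of_ne h]
      exact .reg (.wDen R') (by simp)

/-- The input registers of the scaled instance are computable in polynomial time, hence have
polynomially many bits. -/
theorem polyBounded_scale_size (R : 𝓡) :
    PolyBounded Instance.size fun I : Instance 𝓡 C => (I.scale arity R).size := by
  have h := fun r => (computable_scale_input (C := C) (arity := arity) R r).polyBounded
    boundedState_input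
  exact polyBounded_card.add (.sum _ fun R' _ =>
    ((h (.wNum R')).add (h (.wDen R'))).add ((h (.wbarNum R')).add (h (.wbarDen R'))))

/-- The position `j` does not depend on the instance, so the divisions unroll into a program without
a loop over digits. -/
theorem computable_signedDigit {V h X : Instance 𝓡 C → ℤ} (hV : Computable V) (hh : Computable h)
    (hX : Computable X) (j : ℕ) : Computable fun I => signedDigit (V I) (h I) (X I) j := by
  have hd : ∀ j, Computable fun I => dropDigits (V I) (h I) (X I) j := by
    intro j
    induction j with
    | zero => exact hV
    | succ j ih => exact (ih.add hh).div hX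
  exact (hd j).sub (hX.mul (hd (j + 1)))

/-- The weighted count of the models with a given cardinality of a predicate is a digit of the WFOMC
for scaled weights. -/
theorem DomainLiftable.ratComputable_wfomcOn_card (hΓ : DomainLiftable Γ) (R : 𝓡) (k : ℕ) :
    RatComputable fun I : Instance 𝓡 C => wfomcOn I.c Γ I.w I.wbar {ω | card R ω = k} := by
  classical
  obtain ⟨p, q, hp, hq, hpq⟩ := hΓ.call (Instance.scale arity R) (polyBounded_scale_size R)
    (computable_scale_input R)
  have hX : Computable fun I : Instance 𝓡 C => ((I.w R).den : ℤ) * I.numScale arity :=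
    (PolyComputable.reg (.wDen R) (by simp)).mul computable_numScale
  have hden := computable_denom (𝓡 := 𝓡) (arity := arity) (C := C)
  -- The output `p / q` times the denominator is an integer (`hV`), so the machine's division is
  -- exact; the count is digit `k` over that denominator.
  refine ⟨_, _, computable_signedDigit ((hp.mul hden).div hq) (hden.mul hden) hX k, hden,
    fun I => ?_⟩
  have hD := I.one_le_denom (arity := arity)
  have hD0 : (I.denom arity : ℚ) ≠ 0 := by
    rw [Int.cast_ne_zero]
    omega
  refine ⟨by omega, ?_⟩
  set D := I.denom arity with hDdef
  set X : ℤ := (I.w R).den * I.numScale arity with hXdef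
  choose b hb using fun j : ℕ => exists_int_weightScale_mul_wfomcOn I.c Γ I.w I.wbar
    I.card_pow_le_atomBound {ω : World arity I.Δ | card R ω = j}
  have hb' : ∀ j, wfomcOn I.c Γ I.w I.wbar {ω | card R ω = j} = b j / D := by
    intro j
    rw [eq_div_iff hD0, ← hb, hDdef, Instance.denom]
    push_cast
    ring
  have habs : ∀ j, |b j| ≤ D * D := by
    intro j
    have h := abs_wfomcOn_le I.c Γ I.w I.wbar I.card_pow_le_atomBound
      {ω : World arity I.Δ | card R ω = j}
    have hD' : (0 : ℚ) < D := by exact_mod_cast (by omega : 0 < D)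
    rw [hb' j, abs_div, abs_of_pos hD', div_le_iff₀ hD'] at h
    have : ((|b j| : ℤ) : ℚ) ≤ ((D * D : ℤ) : ℚ) := by
      push_cast
      simpa [hDdef, Instance.denom] using h
    exact_mod_cast this
  have hXD : 2 * (D * D) < X := by
    have h1 : (1 : ℤ) ≤ (I.w R).den := by exact_mod_cast (I.w R).pos
    have h2 : I.numScale arity = 2 * (D * D) + 1 := rfl
    have h3 : 0 ≤ D * D := mul_self_nonneg D
    rw [hXdef, h2]
    nlinarith
  have hM : ∀ l, Fintype.card I.Δ ^ arity R < l → b l = 0 := by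
    intro l hl
    have := hb l
    rw [wfomcOn_card_eq_zero _ _ _ _ R hl, mul_zero] at this
    exact_mod_cast this.symm
  have hV : p I * D / q I =
      ∑ l ∈ Finset.range (Fintype.card I.Δ ^ arity R + 1), b l * X ^ l := by
    refine Int.ediv_eq_of_eq_mul_left (hpq I).1 ?_
    have hval : (p I / q I : ℚ) = ∑ j ∈ Finset.range (Fintype.card I.Δ ^ arity R + 1),
        (b j / D : ℚ) * (X : ℚ) ^ j := by
      rw [(hpq I).2]
      simp only [← hb']
      exact wfomc_update I.c Γ I.w I.wbar R (X : ℚ)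
    have hq0 : (q I : ℚ) ≠ 0 := Int.cast_ne_zero.2 (hpq I).1
    rw [div_eq_iff hq0] at hval
    have : ((p I * D : ℤ) : ℚ) = ((∑ l ∈ Finset.range (Fintype.card I.Δ ^ arity R + 1),
        b l * X ^ l) * q I : ℤ) := by
      push_cast
      rw [hval, mul_right_comm, Finset.sum_mul]
      congr 1
      refine Finset.sum_congr rfl fun j _ => ?_
      field_simp
    exact_mod_cast this
  rw [hV, signedDigit_sum habs hXD hM]
  exact (hb' k).symm

/-! ### Closure of liftability under constraints and connectives -/

open Classical in
theorem wfomc_inf_eq_sum {Δ K : Type} [Fintype Δ] [CommSemiring K] (c : C → Δ)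
    (w wbar : 𝓡 → K) (κ : CardConstraint 𝓡) (s : Finset ℕ)
    (hs : ∀ j, κ.cmp.Holds j κ.bound ↔ j ∈ s) :
    wfomc c (Γ ⊓ κ.toSentence) w wbar =
      ∑ j ∈ s, wfomcOn c Γ w wbar {ω | card κ.pred ω = j} := by
  simp only [wfomc_eq_sum, wfomcOn_eq_sum, models_inf, models_toSentence, CardConstraint.Holds, hs]
  rw [Finset.sum_comm]
  refine Finset.sum_congr rfl fun ω _ => ?_
  by_cases h : Models c ω Γ <;> simp [h]

theorem wfomc_add_eq {Δ K : Type} [Fintype Δ] [CommSemiring K] (c : C → Δ)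
    (w wbar : 𝓡 → K) {Γ₁ Γ₂ : (lang arity C).Sentence}
    (h : ∀ ω : World arity Δ, Models c ω Γ₂ ↔ Models c ω Γ ∧ ¬ Models c ω Γ₁)
    (h' : ∀ ω : World arity Δ, Models c ω Γ₁ → Models c ω Γ) :
    wfomc c Γ₁ w wbar + wfomc c Γ₂ w wbar = wfomc c Γ w wbar := by
  classical
  simp only [wfomc_eq_sum, ← Finset.sum_add_distrib, h]
  refine Finset.sum_congr rfl fun ω _ => ?_
  by_cases h₁ : Models c ω Γ₁
  · simp [h₁, h' ω h₁]
  · simp [h₁]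

/-- Counts are additive, so the count of the models of `Γ` outside `Γ₁` is a difference. All
negations go through this. -/
theorem DomainLiftable.diff {Γ₁ Γ₂ : (lang arity C).Sentence} (hΓ : DomainLiftable Γ)
    (hΓ₁ : DomainLiftable Γ₁)
    (h : ∀ (Δ : Type) (c : C → Δ) (ω : World arity Δ),
      Models c ω Γ₂ ↔ Models c ω Γ ∧ ¬ Models c ω Γ₁)
    (h' : ∀ (Δ : Type) (c : C → Δ) (ω : World arity Δ), Models c ω Γ₁ → Models c ω Γ) :
    DomainLiftable Γ₂ := by
  rw [domainLiftable_iff] at *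
  convert hΓ.sub hΓ₁ using 2 with I
  rw [← wfomc_add_eq I.c I.w I.wbar (h I.Δ I.c) (h' I.Δ I.c), add_sub_cancel_left]

theorem DomainLiftable.congr {Γ' : (lang arity C).Sentence} (hΓ : DomainLiftable Γ)
    (h : ∀ (Δ : Type) (c : C → Δ) (ω : World arity Δ), Models c ω Γ ↔ Models c ω Γ') :
    DomainLiftable Γ' := by
  rw [domainLiftable_iff] at *
  convert hΓ using 2 with I
  classical
  simp only [wfomc_eq_sum]
  exact Finset.sum_congr rfl fun ω _ => if_congr (h _ _ _).symm rfl rfl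

theorem DomainLiftable.inf_of_finset (hΓ : DomainLiftable Γ) (κ : CardConstraint 𝓡)
    (s : Finset ℕ) (hs : ∀ j, κ.cmp.Holds j κ.bound ↔ j ∈ s) :
    DomainLiftable (Γ ⊓ κ.toSentence) := by
  rw [domainLiftable_iff]
  convert RatComputable.sum s fun j => hΓ.ratComputable_wfomcOn_card κ.pred j using 2 with I
  exact wfomc_inf_eq_sum I.c I.w I.wbar κ s hs

theorem DomainLiftable.inf_card (hΓ : DomainLiftable Γ) (κ : CardConstraint 𝓡) :
    DomainLiftable (Γ ⊓ κ.toSentence) := by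
  have compl : ∀ κ' : CardConstraint 𝓡, DomainLiftable (Γ ⊓ κ'.toSentence) →
      κ'.pred = κ.pred → (∀ j, κ.cmp.Holds j κ.bound ↔ ¬ κ'.cmp.Holds j κ'.bound) →
      DomainLiftable (Γ ⊓ κ.toSentence) := by
    intro κ' h hp hc
    refine hΓ.diff h (fun Δ c ω => ?_) fun Δ c ω hω => (models_inf.1 hω).1
    simp only [models_inf, models_toSentence, CardConstraint.Holds, hc, hp]
    tauto
  obtain ⟨R, cmp, k⟩ := κ
  have lt : DomainLiftable (Γ ⊓ (CardConstraint.mk R .lt k).toSentence) :=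
    hΓ.inf_of_finset _ (Finset.range k) fun j => by simp [Cmp.Holds]
  have le : DomainLiftable (Γ ⊓ (CardConstraint.mk R .le k).toSentence) :=
    hΓ.inf_of_finset _ (Finset.range (k + 1)) fun j => by simp [Cmp.Holds]
  cases cmp with
  | eq => exact hΓ.inf_of_finset _ {k} fun j => by simp [Cmp.Holds]
  | le => exact le
  | lt => exact lt
  | ge => exact compl ⟨R, .lt, k⟩ lt rfl fun j => by simp [Cmp.Holds]
  | gt => exact compl ⟨R, .le, k⟩ le rfl fun j => by simp [Cmp.Holds]

theorem DomainLiftable.inf_not {φ : (lang arity C).Sentence} (hΓ : DomainLiftable Γ)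
    (h : DomainLiftable (Γ ⊓ φ)) : DomainLiftable (Γ ⊓ φ.not) :=
  hΓ.diff h (fun _ _ _ => by simp only [models_inf, models_not]; tauto)
    fun _ _ _ hω => (models_inf.1 hω).1

/-- The induction must allow every liftable `Γ`, so that a conjunction can be added one conjunct at
a time. Implication is the complement within `Γ` of `Γ ⊓ φ ⊓ χ.not`; the connectives `or` and `iff`
reduce to implications. -/
theorem DomainLiftable.inf_subst {V : Type} (σ : V → (lang arity C).Sentence)
    (hσ : ∀ (x : V) (Γ : (lang arity C).Sentence), DomainLiftable Γ → DomainLiftable (Γ ⊓ σ x))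
    (ψ : PropFormula V) (hΓ : DomainLiftable Γ) : DomainLiftable (Γ ⊓ ψ.subst σ) := by
  have and_not : ∀ {Γ φ χ : (lang arity C).Sentence},
      (∀ {Γ}, DomainLiftable Γ → DomainLiftable (Γ ⊓ φ)) →
      (∀ {Γ}, DomainLiftable Γ → DomainLiftable (Γ ⊓ χ)) → DomainLiftable Γ →
      DomainLiftable (Γ ⊓ φ.imp χ) := by
    intro Γ φ χ hφ hχ hΓ
    have h := (hφ hΓ).inf_not (hχ (hφ hΓ))
    refine hΓ.diff h (fun _ _ _ => ?_) fun _ _ _ hω => (models_inf.1 (models_inf.1 hω).1).1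
    simp only [models_inf, models_not, models_imp]
    tauto
  induction ψ generalizing Γ with
  | var x => exact hσ x Γ hΓ
  | false =>
    -- The count is zero, obtained as `Γ` minus itself.
    exact hΓ.diff hΓ (fun _ _ _ => by simp [models_inf, PropFormula.subst, models_bot])
      fun _ _ _ => id
  | not φ ih => exact hΓ.inf_not (ih hΓ)
  | and φ χ ih ih' =>
    exact (ih' (ih hΓ)).congr fun _ _ _ => by simp only [PropFormula.subst, models_inf]; tauto
  | or φ χ ih ih' =>
    refine (and_not (φ := (φ.subst σ).not) (fun h => h.inf_not (ih h)) ih' hΓ).congr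
      fun _ _ _ => ?_
    simp only [PropFormula.subst, models_inf, models_imp, models_not, models_sup]
    tauto
  | imp φ χ ih ih' => exact and_not ih ih' hΓ
  | iff φ χ ih ih' =>
    refine (and_not ih' ih (and_not ih ih' hΓ)).congr fun _ _ _ => ?_
    simp only [PropFormula.subst, models_inf, models_imp, models_iff]
    tauto

end Constraint

end WFOMC

open Classical in
theorem mainTheorem5 {𝓡 : Type} [Fintype 𝓡] {arity : 𝓡 → ℕ} {C : Type} [Finite C]
    (Γ : (WFOMC.lang arity C).Sentence) {m : ℕ} (ψ : WFOMC.PropFormula (Fin m))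
    (κ : Fin m → WFOMC.CardConstraint 𝓡) (hΓ : WFOMC.DomainLiftable Γ) :
    WFOMC.DomainLiftable (Γ ⊓ ψ.subst fun i => (κ i).toSentence) ∧
    (∀ (Δ : Type) [Fintype Δ] (c : C ↪ Δ) (w wbar : 𝓡 → ℂ),
      WFOMC.wfomc c (Γ ⊓ ψ.subst fun i => (κ i).toSentence) w wbar =
        ∑ n ∈ WFOMC.cardVectors arity (fun i => (κ i).pred) (Fintype.card Δ),
          if ψ.Holds fun i => (κ i).cmp.Holds (n i) (κ i).bound then
            WFOMC.wmc c (fun i => (κ i).pred) Γ n w wbar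
          else 0) ∧
    ∃ Q : Polynomial ℕ, ∀ N : ℕ,
      (WFOMC.cardVectors arity (fun i => (κ i).pred) N).card ≤ Q.eval N := by
  refine ⟨hΓ.inf_subst _ (fun i _ h => h.inf_card (κ i)) ψ, fun Δ _ c w wbar => ?_,
    ∏ i, (Polynomial.X ^ arity (κ i).pred + 1), fun N => ?_⟩
  · simp only [WFOMC.wmc, WFOMC.wfomc_eq_sum, WFOMC.wfomcOn_eq_sum, Finset.ite_sum_zero]
    rw [Finset.sum_comm]
    refine Finset.sum_congr rfl fun ω _ => ?_
    have hmem : (fun i => WFOMC.card (κ i).pred ω) ∈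
        WFOMC.cardVectors arity (fun i => (κ i).pred) (Fintype.card Δ) :=
      Fintype.mem_piFinset.2 fun i =>
        Finset.mem_range.2 (Nat.lt_succ_of_le (WFOMC.card_le (κ i).pred ω))
    -- After exchanging the sums, a world can contribute only at its own cardinality vector.
    rw [Finset.sum_eq_single_of_mem _ hmem]
    · simp only [WFOMC.models_inf, WFOMC.models_subst, WFOMC.models_toSentence,
        WFOMC.CardConstraint.Holds, Set.mem_ofPred_eq, WFOMC.models_top]
      by_cases h : WFOMC.Models c ω Γ <;> simp [h]
    · intro n _ hn
      have : ¬ ∀ i, WFOMC.card (κ i).pred ω = n i := fun h => hn (funext fun i => (h i).symm)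
      simp [this]
  · simp [WFOMC.cardVectors, Polynomial.eval_prod]
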